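/- Throughout, manifolds are smooth, finite-dimensional, Hausdorff, second countable and without boundary. Let $M$ be a smooth manifold and $G$ a Lie group. **Path groupoid.** A path $\gamma:x\to y$ in a manifold $X$ is a smooth map $\gamma:[0,1]\to X$ for which there is $0<\epsilon<\tfrac12$ with $\gamma(t)=x$ for $t<\epsilon$ and $\gamma(t)=y$ for $t>1-\epsilon$. Two paths $\gamma_1,\gamma_2:x\to y$ are thin homotopy equivalent if there are a smooth map $h:[0,1]\times[0,1]\to X$ and $0<\epsilon<\tfrac12$ such that $h(s,t)=x$ for $t<\epsilon$, $h(s,t)=y$ for $t>1-\epsilon$, $h(s,t)=\gamma_1(t)$ for $s<\epsilon$, $h(s,t)=\gamma_2(t)$ for $s>1-\epsilon$, and the differential of $h$ has rank at most $1$ everywhere. The path groupoid $\mathcal P_1(X)$ has the points of $X$ as objects and thin homotopy classes $\overline\gamma:x\to y$ of paths as morphisms; composition is concatenation of paths (each at double speed). A smooth map $f:X\to X'$ induces a functor $f_*:\mathcal P_1(X)\to\mathcal P_1(X')$, $\overline\gamma\mapsto\overline{f\circ\gamma}$. The thin homotopy group $\pi_1^1(M,x)$ is the group of automorphisms of $x$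 in $\mathcal P_1(M)$. A family $c$ of paths in $X$ indexed by an open set $U\subset\mathbb R^m$, $m\geq 0$, is called smooth if $(u,t)\mapsto c(u)(t)$ is smooth on $U\times[0,1]$. **Transport functors.** $G\text{-}\mathrm{Tor}$ is the category of non-empty smooth manifolds with a smooth, free and transitive right $G$-action, and smooth equivariant maps. $\mathcal BG$ is the groupoid with one object, morphisms $G$ and composition $g_2\circ g_1=g_2g_1$. The functor $i_G:\mathcal BG\to G\text{-}\mathrm{Tor}$ sends the object to $G$ (with right multiplication) and $g$ to left multiplication by $g$. A functor $F:\mathcal P_1(X)\to\mathcal BG$ is smooth if $u\mapsto F(\overline{c(u)})\in G$ is smooth on $U$ for every smooth family of paths $c$ in $X$ indexed by an open $U\subset\mathbb R^m$. A transport functor on $M$ with $\mathcal BG$-structure is a functor $\mathrm{tra}:\mathcal P_1(M)\to G\text{-}\mathrm{Tor}$ for which there exist a surjective submersion $\pi:Y\to M$, a smooth functor $\mathrm{triv}:\mathcal P_1(Y)\to\mathcal BG$ and a natural equivalence $t:\mathrm{tra}\circ\pi_*\to i_G\circ\mathrm{triv}$ such that $t(y_2)\circ t(y_1)^{-1}=i_G(\tilde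 g(y_1,y_2))$ for all $(y_1,y_2)\in Y\times_M Y$, with a smooth function $\tilde g:Y\times_M Y\to G$. **Proposition.** Let $\mathrm{tra}:\mathcal P_1(M)\to G\text{-}\mathrm{Tor}$ be a transport functor on $M$ with $\mathcal BG$-structure, let $x\in M$, and let $\varphi:\mathrm{tra}(x)\to G$ be any isomorphism in $G\text{-}\mathrm{Tor}$. Identify $\mathrm{Mor}_{G\text{-}\mathrm{Tor}}(G,G)$ with $G$ through $i_G$. Then the map $$\mathrm{tra}_{x,x}:\pi_1^1(M,x)\to G,\qquad \overline\gamma\mapsto \varphi\circ\mathrm{tra}(\overline\gamma)\circ\varphi^{-1},$$ is a holonomy map. That is, it is a group homomorphism, and for every $m\geq 0$, every open $U\subset\mathbb R^m$ and every smooth family $c$ of paths $c(u):x\to x$ indexed by $U$, the map $U\to G$, $u\mapsto\mathrm{tra}_{x,x}(\overline{c(u)})$, is smooth. -/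

import Mathlib

open CategoryTheory
open scoped Manifold ContDiff

universe u w

namespace PathTransport

noncomputable section

/-! ## Paths and thin homotopies -/

section Paths

variable {n : ℕ} {M : Type u} [TopologicalSpace M] [ChartedSpace (EuclideanSpace ℝ (Fin n)) M]

/-- A path `γ : x → y` in the `n`-dimensional manifold `M`: a smooth map `[0,1] → M` with sitting
instants. Thanks to the sitting instants such a map has a unique smooth extension to `ℝ` that is
equal to `x` on `(-∞, 0]` and to `y` on `[1, ∞)`; a path is stored as this extension. -/
structure SmoothPath (n : ℕ) {M : Type u} [TopologicalSpace M]
    [ChartedSpace (EuclideanSpace ℝ (Fin n)) M] (x y : M) where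
  toFun : ℝ → M
  smooth : ContMDiff 𝓘(ℝ, ℝ) (𝓡 n) ∞ toFun
  sitting : ∃ ε : ℝ, 0 < ε ∧ ε < 1 / 2 ∧ (∀ t, t < ε → toFun t = x) ∧
    (∀ t, 1 - ε < t → toFun t = y)

/-- A thin homotopy from `γ₁` to `γ₂`: a smooth map `h` of `(s, t) ∈ [0,1] × [0,1]` which is
constant for `t` near the ends, equal to `γ₁` and `γ₂` for `s` near the ends, and whose differential
has rank at most one everywhere. As for paths, `h` is stored as its constant extension to `ℝ × ℝ`. -/
structure IsThinHomotopy {x y : M} (γ₁ γ₂ : SmoothPath n x y) (h : ℝ × ℝ → M) : Prop where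
  smooth : ContMDiff 𝓘(ℝ, ℝ × ℝ) (𝓡 n) ∞ h
  sitting : ∃ ε : ℝ, 0 < ε ∧ ε < 1 / 2 ∧
    (∀ s t, t < ε → h (s, t) = x) ∧ (∀ s t, 1 - ε < t → h (s, t) = y) ∧
    (∀ s t, s < ε → h (s, t) = γ₁.toFun t) ∧ (∀ s t, 1 - ε < s → h (s, t) = γ₂.toFun t)
  rank_le_one : ∀ p : ℝ × ℝ,
    LinearMap.rank (mfderiv 𝓘(ℝ, ℝ × ℝ) (𝓡 n) h p).toLinearMap ≤ 1

/-- Two paths with the same ends are thin homotopy equivalent. -/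
def ThinHomotopic {x y : M} (γ₁ γ₂ : SmoothPath n x y) : Prop :=
  ∃ h : ℝ × ℝ → M, IsThinHomotopy γ₁ γ₂ h

/-! ### Auxiliary facts on gluing and on maps of rank at most one -/

/-- Smooth and of rank at most one at a point. -/
structure ThinAt (n : ℕ) {M : Type u} [TopologicalSpace M]
    [ChartedSpace (EuclideanSpace ℝ (Fin n)) M] (h : ℝ × ℝ → M) (p : ℝ × ℝ) : Prop where
  smooth : ContMDiffAt 𝓘(ℝ, ℝ × ℝ) (𝓡 n) ∞ h p
  rank_le_one : LinearMap.rank (mfderiv 𝓘(ℝ, ℝ × ℝ) (𝓡 n) h p).toLinearMap ≤ 1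

theorem IsThinHomotopy.thinAt {x y : M} {γ₁ γ₂ : SmoothPath n x y} {h : ℝ × ℝ → M}
    (H : IsThinHomotopy γ₁ γ₂ h) (p : ℝ × ℝ) : ThinAt n h p :=
  ⟨H.smooth p, H.rank_le_one p⟩

theorem ThinAt.congr {h h' : ℝ × ℝ → M} {p : ℝ × ℝ} (H : ThinAt n h p)
    (e : h' =ᶠ[nhds p] h) : ThinAt n h' p := by
  refine ⟨H.smooth.congr_of_eventuallyEq e, ?_⟩
  have := e.mfderiv_eq (I := 𝓘(ℝ, ℝ × ℝ)) (I' := 𝓡 n)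
  have h2 := H.rank_le_one
  unfold LinearMap.rank at h2 ⊢
  have h3 : h' p = h p := e.self_of_nhds
  revert this
  generalize mfderiv 𝓘(ℝ, ℝ × ℝ) (𝓡 n) h' p = A
  intro this
  subst this
  exact h2

theorem rank_comp_le_rank {V V' V'' : Type} [AddCommGroup V] [Module ℝ V] [TopologicalSpace V]
    [AddCommGroup V'] [Module ℝ V'] [TopologicalSpace V'] [AddCommGroup V''] [Module ℝ V'']
    [TopologicalSpace V''] (g : V' →L[ℝ] V'') (f : V →L[ℝ] V') :
    LinearMap.rank (g.comp f).toLinearMap ≤ LinearMap.rank g.toLinearMap :=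
  LinearMap.rank_comp_le_left f.toLinearMap g.toLinearMap

theorem rank_comp_le_one {V V' V'' : Type} [AddCommGroup V] [Module ℝ V] [TopologicalSpace V]
    [AddCommGroup V'] [Module ℝ V'] [TopologicalSpace V'] [AddCommGroup V''] [Module ℝ V'']
    [TopologicalSpace V''] (g : V' →L[ℝ] V'') (f : V →L[ℝ] V') (h : Module.rank ℝ V' = 1) :
    LinearMap.rank (g.comp f).toLinearMap ≤ 1 :=
  (rank_comp_le_rank g f).trans ((LinearMap.rank_le_domain g.toLinearMap).trans h.le)

theorem thinAt_reparam {γ : ℝ → M} (hγ : ContMDiff 𝓘(ℝ, ℝ) (𝓡 n) ∞ γ) {φ : ℝ × ℝ → ℝ}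
    (hφ : ContDiff ℝ ∞ φ) (p : ℝ × ℝ) : ThinAt n (fun q => γ (φ q)) p := by
  have hφ' : ContMDiff 𝓘(ℝ, ℝ × ℝ) 𝓘(ℝ, ℝ) ∞ φ := hφ.contMDiff
  refine ⟨(hγ.comp hφ') p, ?_⟩
  have := mfderiv_comp (I := 𝓘(ℝ, ℝ × ℝ)) (I' := 𝓘(ℝ, ℝ)) (I'' := 𝓡 n) p
    ((hγ (φ p)).mdifferentiableAt (by simp)) ((hφ' p).mdifferentiableAt (by simp))
  change LinearMap.rank (mfderiv 𝓘(ℝ, ℝ × ℝ) (𝓡 n) (γ ∘ φ) p).toLinearMap ≤ 1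
  rw [this]
  exact rank_comp_le_one (mfderiv 𝓘(ℝ, ℝ) (𝓡 n) γ (φ p)) (mfderiv 𝓘(ℝ, ℝ × ℝ) 𝓘(ℝ, ℝ) φ p)
    (Module.rank_self ℝ)

theorem ThinAt.comp {h : ℝ × ℝ → M} {Φ : ℝ × ℝ → ℝ × ℝ} (hΦ : ContDiff ℝ ∞ Φ) {p : ℝ × ℝ}
    (H : ThinAt n h (Φ p)) : ThinAt n (fun q => h (Φ q)) p := by
  have hΦ' : ContMDiff 𝓘(ℝ, ℝ × ℝ) 𝓘(ℝ, ℝ × ℝ) ∞ Φ := hΦ.contMDiff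
  refine ⟨H.smooth.comp p (hΦ' p), ?_⟩
  have := mfderiv_comp (I := 𝓘(ℝ, ℝ × ℝ)) (I' := 𝓘(ℝ, ℝ × ℝ)) (I'' := 𝓡 n) p
    (H.smooth.mdifferentiableAt (by simp)) ((hΦ' p).mdifferentiableAt (by simp))
  change LinearMap.rank (mfderiv 𝓘(ℝ, ℝ × ℝ) (𝓡 n) (h ∘ Φ) p).toLinearMap ≤ 1
  rw [this]
  exact (rank_comp_le_rank (mfderiv 𝓘(ℝ, ℝ × ℝ) (𝓡 n) h (Φ p))
    (mfderiv 𝓘(ℝ, ℝ × ℝ) 𝓘(ℝ, ℝ × ℝ) Φ p)).trans H.rank_le_one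

open Classical in
/-- Gluing along the zero set of a continuous function. -/
theorem glue_eventuallyEq {X Z : Type*} [TopologicalSpace X] {m : X → ℝ} (hm : Continuous m)
    {f g : X → Z} {p : X} (hfg : m p = 0 → f =ᶠ[nhds p] g) :
    (m p ≤ 0 ∧ (fun q => if m q ≤ 0 then f q else g q) =ᶠ[nhds p] f) ∨
    (0 ≤ m p ∧ (fun q => if m q ≤ 0 then f q else g q) =ᶠ[nhds p] g) := by
  rcases lt_trichotomy (m p) 0 with h | h | h
  · refine Or.inl ⟨h.le, ?_⟩
    filter_upwards [hm.continuousAt.eventually_lt_const h] with q hq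
    simp [hq.le]
  · refine Or.inl ⟨h.le, ?_⟩
    filter_upwards [hfg h] with q hq
    simp [hq]
  · refine Or.inr ⟨h.le, ?_⟩
    filter_upwards [hm.continuousAt.eventually_const_lt h] with q hq
    simp [not_le.mpr hq]

open Classical in
theorem thinAt_glue {m : ℝ × ℝ → ℝ} (hm : Continuous m) {f g : ℝ × ℝ → M} {p : ℝ × ℝ}
    (hf : ThinAt n f p) (hg : ThinAt n g p) (hfg : m p = 0 → f =ᶠ[nhds p] g) :
    ThinAt n (fun q => if m q ≤ 0 then f q else g q) p := by
  rcases glue_eventuallyEq hm hfg with ⟨-, h⟩ | ⟨-, h⟩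
  · exact hf.congr h
  · exact hg.congr h

/-- A smooth function that is `0` for `s ≤ 1/4` and `1` for `3/4 ≤ s`. -/
def step (s : ℝ) : ℝ := Real.smoothTransition (2 * s - 1 / 2)

theorem step_contDiff : ContDiff ℝ ∞ step :=
  Real.smoothTransition.contDiff.comp (by fun_prop)

theorem step_nonneg (s : ℝ) : 0 ≤ step s := Real.smoothTransition.nonneg _

theorem step_le_one (s : ℝ) : step s ≤ 1 := Real.smoothTransition.le_one _

theorem step_zero {s : ℝ} (h : s < 1 / 4) : step s = 0 :=
  Real.smoothTransition.zero_of_nonpos (by linarith)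

theorem step_one {s : ℝ} (h : 1 - 1 / 4 < s) : step s = 1 :=
  Real.smoothTransition.one_of_one_le (by linarith)

/-- If two reparametrizations of one curve both stay in convex parameter sets on which the curve is
constant when `t` is near an end, then the two resulting paths are thin homotopic. -/
theorem thinHomotopic_of_reparam {x y : M} {γ₁ γ₂ : SmoothPath n x y} {c : ℝ → M}
    (hc : ContMDiff 𝓘(ℝ, ℝ) (𝓡 n) ∞ c) {φ ψ : ℝ → ℝ} (hφ : ContDiff ℝ ∞ φ) (hψ : ContDiff ℝ ∞ ψ)
    (h₁ : ∀ t, γ₁.toFun t = c (φ t)) (h₂ : ∀ t, γ₂.toFun t = c (ψ t)) {A B : Set ℝ}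
    (hA : Convex ℝ A) (hB : Convex ℝ B) (hcA : ∀ r ∈ A, c r = x) (hcB : ∀ r ∈ B, c r = y)
    {δ : ℝ} (hδ : 0 < δ) (hA' : ∀ t < δ, φ t ∈ A ∧ ψ t ∈ A)
    (hB' : ∀ t, 1 - δ < t → φ t ∈ B ∧ ψ t ∈ B) : ThinHomotopic γ₁ γ₂ := by
  have hs : ContDiff ℝ ∞ (fun p : ℝ × ℝ => (1 - step p.1) * φ p.2 + step p.1 * ψ p.2) := by
    have := step_contDiff
    fun_prop
  have key : ∀ p : ℝ × ℝ, _ := fun p => thinAt_reparam (n := n) hc hs p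
  refine ⟨fun p => c ((1 - step p.1) * φ p.2 + step p.1 * ψ p.2),
    ⟨fun p => (key p).smooth, ⟨min δ (1 / 4), lt_min hδ (by norm_num),
      lt_of_le_of_lt (min_le_right _ _) (by norm_num), ?_, ?_, ?_, ?_⟩,
      fun p => (key p).rank_le_one⟩⟩
  · intro s t ht
    have := hA' t (lt_of_lt_of_le ht (min_le_left _ _))
    exact hcA _ (hA this.1 this.2 (by linarith [step_le_one s]) (step_nonneg s) (by ring))
  · intro s t ht
    have := hB' t (by linarith [min_le_left δ (1 / 4)])
    exact hcB _ (hB this.1 this.2 (by linarith [step_le_one s]) (step_nonneg s) (by ring))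
  · intro s t ht
    simp [step_zero (lt_of_lt_of_le ht (min_le_right _ _)), h₁]
  · intro s t ht
    simp [step_one (s := s) (by linarith [min_le_right δ (1 / 4)]), h₂]

/-! ### Thin homotopy is an equivalence relation -/

theorem ThinHomotopic.refl {x y : M} (γ : SmoothPath n x y) : ThinHomotopic γ γ := by
  obtain ⟨ε, h0, -, hx, hy⟩ := γ.sitting
  exact thinHomotopic_of_reparam (c := γ.toFun) (φ := id) (ψ := id) γ.smooth contDiff_id contDiff_id
    (fun _ => rfl) (fun _ => rfl) (convex_Iio ε) (convex_Ioi (1 - ε)) hx hy h0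
    (fun t ht => ⟨ht, ht⟩) (fun t ht => ⟨ht, ht⟩)

theorem ThinHomotopic.symm {x y : M} {γ₁ γ₂ : SmoothPath n x y} (H : ThinHomotopic γ₁ γ₂) :
    ThinHomotopic γ₂ γ₁ := by
  obtain ⟨h, H⟩ := H
  obtain ⟨ε, h0, h1, ha, hb, hc, hd⟩ := H.sitting
  have key : ∀ p : ℝ × ℝ, ThinAt n (fun q : ℝ × ℝ => h ((fun q : ℝ × ℝ => (1 - q.1, q.2)) q)) p :=
    fun p => (H.thinAt _).comp (by fun_prop)
  exact ⟨_, fun p => (key p).smooth, ⟨ε, h0, h1, fun s t ht => ha _ _ ht, fun s t ht => hb _ _ ht,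
    fun s t hs => hd _ _ (by dsimp only; linarith), fun s t hs => hc _ _ (by dsimp only; linarith)⟩,
    fun p => (key p).rank_le_one⟩

open Classical in
theorem ThinHomotopic.trans {x y : M} {γ₁ γ₂ γ₃ : SmoothPath n x y} (H : ThinHomotopic γ₁ γ₂)
    (K : ThinHomotopic γ₂ γ₃) : ThinHomotopic γ₁ γ₃ := by
  obtain ⟨h, H⟩ := H
  obtain ⟨k, K⟩ := K
  obtain ⟨ε, h0, h1, ha, hb, hc, hd⟩ := H.sitting
  obtain ⟨δ, k0, k1, ka, kb, kc, kd⟩ := K.sitting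
  have key : ∀ p : ℝ × ℝ, ThinAt n (fun q : ℝ × ℝ => if q.1 - 1 / 2 ≤ 0
      then h ((fun q : ℝ × ℝ => (2 * q.1, q.2)) q)
      else k ((fun q : ℝ × ℝ => (2 * q.1 - 1, q.2)) q)) p := by
    intro p
    refine thinAt_glue (m := fun q : ℝ × ℝ => q.1 - 1 / 2) (by fun_prop)
      ((H.thinAt _).comp (by fun_prop)) ((K.thinAt _).comp (by fun_prop)) ?_
    intro hp
    have e1 : ∀ᶠ q : ℝ × ℝ in nhds p, 1 - ε < 2 * q.1 :=
      (show Continuous (fun q : ℝ × ℝ => 2 * q.1) by fun_prop).continuousAt.eventually_const_lt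
        (by dsimp only at hp ⊢; linarith)
    have e2 : ∀ᶠ q : ℝ × ℝ in nhds p, 2 * q.1 - 1 < δ :=
      (show Continuous (fun q : ℝ × ℝ => 2 * q.1 - 1) by fun_prop).continuousAt.eventually_lt_const
        (by dsimp only at hp ⊢; linarith)
    filter_upwards [e1, e2] with q hq1 hq2
    rw [hd _ _ hq1, kc _ _ hq2]
  refine ⟨_, fun p => (key p).smooth, ⟨min ε δ / 2, by positivity, ?_, ?_, ?_, ?_, ?_⟩,
    fun p => (key p).rank_le_one⟩
  · linarith [min_le_left ε δ]
  · intro s t ht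
    have m1 := min_le_left ε δ
    have m2 := min_le_right ε δ
    have m0 := lt_min h0 k0
    dsimp only
    split_ifs
    · exact ha _ _ (by linarith)
    · exact ka _ _ (by linarith)
  · intro s t ht
    have m1 := min_le_left ε δ
    have m2 := min_le_right ε δ
    have m0 := lt_min h0 k0
    dsimp only
    split_ifs
    · exact hb _ _ (by linarith)
    · exact kb _ _ (by linarith)
  · intro s t hs
    have m1 := min_le_left ε δ
    dsimp only
    rw [if_pos (by linarith)]
    exact hc _ _ (by linarith)
  · intro s t hs
    have m1 := min_le_left ε δ
    have m2 := min_le_right ε δ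
    dsimp only
    rw [if_neg (by linarith)]
    exact kd _ _ (by linarith)

/-- Thin homotopy as a setoid on the paths from `x` to `y`. -/
instance thinSetoid (n : ℕ) {M : Type u} [TopologicalSpace M]
    [ChartedSpace (EuclideanSpace ℝ (Fin n)) M] (x y : M) : Setoid (SmoothPath n x y) :=
  ⟨ThinHomotopic, ThinHomotopic.refl, ThinHomotopic.symm, ThinHomotopic.trans⟩

/-! ### Constant paths, inverses and composition -/

/-- The constant path. -/
def SmoothPath.const (n : ℕ) {M : Type u} [TopologicalSpace M]
    [ChartedSpace (EuclideanSpace ℝ (Fin n)) M] (x : M) : SmoothPath n x x :=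
  ⟨fun _ => x, contMDiff_const, 1 / 4, by norm_num, by norm_num, fun _ _ => rfl, fun _ _ => rfl⟩

/-- The inverse path `t ↦ γ (1 - t)`. -/
def SmoothPath.inv {x y : M} (γ : SmoothPath n x y) : SmoothPath n y x where
  toFun t := γ.toFun (1 - t)
  smooth := γ.smooth.comp (ContDiff.contMDiff (by fun_prop))
  sitting := by
    obtain ⟨ε, h0, h1, hx, hy⟩ := γ.sitting
    exact ⟨ε, h0, h1, fun t ht => hy _ (by linarith), fun t ht => hx _ (by linarith)⟩

open Classical in
/-- The composition `γ₂ ∘ γ₁`: first `γ₁`, then `γ₂`, each at double speed. -/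
def SmoothPath.comp {x y z : M} (γ₂ : SmoothPath n y z) (γ₁ : SmoothPath n x y) :
    SmoothPath n x z where
  toFun t := if t ≤ 1 / 2 then γ₁.toFun (2 * t) else γ₂.toFun (2 * t - 1)
  smooth := by
    obtain ⟨ε, h0, h1, hx, hy⟩ := γ₁.sitting
    obtain ⟨δ, k0, k1, ky, kz⟩ := γ₂.sitting
    intro t
    have s1 : ContMDiffAt 𝓘(ℝ, ℝ) (𝓡 n) ∞ (fun t => γ₁.toFun (2 * t)) t :=
      (γ₁.smooth.comp (ContDiff.contMDiff (by fun_prop : ContDiff ℝ ∞ fun t : ℝ => 2 * t))) t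
    have s2 : ContMDiffAt 𝓘(ℝ, ℝ) (𝓡 n) ∞ (fun t => γ₂.toFun (2 * t - 1)) t :=
      (γ₂.smooth.comp (ContDiff.contMDiff (by fun_prop : ContDiff ℝ ∞ fun t : ℝ => 2 * t - 1))) t
    have e := glue_eventuallyEq (m := fun t : ℝ => t - 1 / 2) (by fun_prop) (p := t)
      (f := fun t => γ₁.toFun (2 * t)) (g := fun t => γ₂.toFun (2 * t - 1)) (by
        intro hp
        have e1 : ∀ᶠ q : ℝ in nhds t, 1 - ε < 2 * q :=
          (show Continuous (fun q : ℝ => 2 * q) by fun_prop).continuousAt.eventually_const_lt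
            (by dsimp only at hp ⊢; linarith)
        have e2 : ∀ᶠ q : ℝ in nhds t, 2 * q - 1 < δ :=
          (show Continuous (fun q : ℝ => 2 * q - 1) by fun_prop).continuousAt.eventually_lt_const
            (by dsimp only at hp ⊢; linarith)
        filter_upwards [e1, e2] with q hq1 hq2
        rw [hy _ hq1, ky _ hq2])
    simp only [sub_nonpos] at e
    rcases e with ⟨-, e⟩ | ⟨-, e⟩
    · exact s1.congr_of_eventuallyEq e
    · exact s2.congr_of_eventuallyEq e
  sitting := by
    obtain ⟨ε, h0, h1, hx, hy⟩ := γ₁.sitting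
    obtain ⟨δ, k0, k1, ky, kz⟩ := γ₂.sitting
    have m1 := min_le_left ε δ
    have m2 := min_le_right ε δ
    have m0 := lt_min h0 k0
    refine ⟨min ε δ / 2, by linarith, by linarith, fun t ht => ?_, fun t ht => ?_⟩
    · rw [if_pos (by linarith)]
      exact hx _ (by linarith)
    · rw [if_neg (by linarith)]
      exact kz _ (by linarith)

open Classical in
theorem comp_congr {x y z : M} {γ₂ γ₂' : SmoothPath n y z} {γ₁ γ₁' : SmoothPath n x y}
    (K : ThinHomotopic γ₂ γ₂') (H : ThinHomotopic γ₁ γ₁') :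
    ThinHomotopic (γ₂.comp γ₁) (γ₂'.comp γ₁') := by
  obtain ⟨h, H⟩ := H
  obtain ⟨k, K⟩ := K
  obtain ⟨ε, h0, h1, ha, hb, hc, hd⟩ := H.sitting
  obtain ⟨δ, k0, k1, ka, kb, kc, kd⟩ := K.sitting
  have key : ∀ p : ℝ × ℝ, ThinAt n (fun q : ℝ × ℝ => if q.2 - 1 / 2 ≤ 0
      then h ((fun q : ℝ × ℝ => (q.1, 2 * q.2)) q)
      else k ((fun q : ℝ × ℝ => (q.1, 2 * q.2 - 1)) q)) p := by
    intro p
    refine thinAt_glue (m := fun q : ℝ × ℝ => q.2 - 1 / 2) (by fun_prop)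
      ((H.thinAt _).comp (by fun_prop)) ((K.thinAt _).comp (by fun_prop)) ?_
    intro hp
    have e1 : ∀ᶠ q : ℝ × ℝ in nhds p, 1 - ε < 2 * q.2 :=
      (show Continuous (fun q : ℝ × ℝ => 2 * q.2) by fun_prop).continuousAt.eventually_const_lt
        (by dsimp only at hp ⊢; linarith)
    have e2 : ∀ᶠ q : ℝ × ℝ in nhds p, 2 * q.2 - 1 < δ :=
      (show Continuous (fun q : ℝ × ℝ => 2 * q.2 - 1) by fun_prop).continuousAt.eventually_lt_const
        (by dsimp only at hp ⊢; linarith)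
    filter_upwards [e1, e2] with q hq1 hq2
    rw [hb _ _ hq1, ka _ _ hq2]
  have m1 := min_le_left ε δ
  have m2 := min_le_right ε δ
  have m0 := lt_min h0 k0
  refine ⟨_, fun p => (key p).smooth, ⟨min ε δ / 2, by linarith, by linarith, ?_, ?_, ?_, ?_⟩,
    fun p => (key p).rank_le_one⟩
  · intro s t ht
    dsimp only
    rw [if_pos (by linarith)]
    exact ha _ _ (by linarith)
  · intro s t ht
    dsimp only
    rw [if_neg (by linarith)]
    exact kb _ _ (by linarith)
  · intro s t hs
    simp only [SmoothPath.comp, sub_nonpos]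
    rw [hc _ _ (by linarith), kc _ _ (by linarith)]
  · intro s t hs
    simp only [SmoothPath.comp, sub_nonpos]
    rw [hd _ _ (by linarith), kd _ _ (by linarith)]

theorem inv_congr {x y : M} {γ γ' : SmoothPath n x y} (H : ThinHomotopic γ γ') :
    ThinHomotopic γ.inv γ'.inv := by
  obtain ⟨h, H⟩ := H
  obtain ⟨ε, h0, h1, ha, hb, hc, hd⟩ := H.sitting
  have key : ∀ p : ℝ × ℝ, ThinAt n (fun q : ℝ × ℝ => h ((fun q : ℝ × ℝ => (q.1, 1 - q.2)) q)) p :=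
    fun p => (H.thinAt _).comp (by fun_prop)
  exact ⟨_, fun p => (key p).smooth, ⟨ε, h0, h1,
    fun s t ht => hb _ _ (by dsimp only; linarith), fun s t ht => ha _ _ (by dsimp only; linarith),
    fun s t hs => hc _ _ hs, fun s t hs => hd _ _ hs⟩, fun p => (key p).rank_le_one⟩

theorem comp_const {x y : M} (γ : SmoothPath n x y) :
    ThinHomotopic (γ.comp (SmoothPath.const n x)) γ := by
  obtain ⟨ε, h0, h1, hx, hy⟩ := γ.sitting
  refine thinHomotopic_of_reparam (c := γ.toFun) (φ := fun t => 2 * t - 1) (ψ := id) γ.smooth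
    (by fun_prop) contDiff_id ?_ (fun _ => rfl) (convex_Iio ε) (convex_Ioi (1 - ε)) hx hy
    (δ := ε / 2) (by linarith) (fun t ht => ?_) (fun t ht => ?_)
  · intro t
    simp only [SmoothPath.comp, SmoothPath.const]
    split_ifs with h
    · rw [hx _ (by linarith)]
    · rfl
  · simp only [Set.mem_Iio, id]
    constructor <;> linarith
  · simp only [Set.mem_Ioi, id]
    constructor <;> linarith

theorem const_comp {x y : M} (γ : SmoothPath n x y) :
    ThinHomotopic ((SmoothPath.const n y).comp γ) γ := by
  obtain ⟨ε, h0, h1, hx, hy⟩ := γ.sitting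
  refine thinHomotopic_of_reparam (c := γ.toFun) (φ := fun t => 2 * t) (ψ := id) γ.smooth
    (by fun_prop) contDiff_id ?_ (fun _ => rfl) (convex_Iio ε) (convex_Ioi (1 - ε)) hx hy
    (δ := ε / 2) (by linarith) (fun t ht => ?_) (fun t ht => ?_)
  · intro t
    simp only [SmoothPath.comp, SmoothPath.const]
    split_ifs with h
    · rfl
    · rw [hy _ (by linarith)]
  · simp only [Set.mem_Iio, id]
    constructor <;> linarith
  · simp only [Set.mem_Ioi, id]
    constructor <;> linarith

theorem inv_inv {x y : M} (γ : SmoothPath n x y) : γ.inv.inv = γ := by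
  cases γ
  simp [SmoothPath.inv]

theorem comp_inv {x y : M} (γ : SmoothPath n x y) :
    ThinHomotopic (γ.comp γ.inv) (SmoothPath.const n y) := by
  obtain ⟨ε, h0, h1, hx, hy⟩ := γ.sitting
  have hχ : ContDiff ℝ ∞ Real.smoothTransition := Real.smoothTransition.contDiff
  let χ : ℝ → ℝ := fun w => Real.smoothTransition (2 / ε * w)
  have χ1 : ∀ w, ε / 2 ≤ w → χ w = 1 := fun w hw => by
    apply Real.smoothTransition.one_of_one_le
    calc (1 : ℝ) = 2 / ε * (ε / 2) := by field_simp
      _ ≤ 2 / ε * w := by gcongr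
  have χ0 : ∀ w, w ≤ 0 → χ w = 0 := fun w hw =>
    Real.smoothTransition.zero_of_nonpos (mul_nonpos_of_nonneg_of_nonpos (by positivity) hw)
  have χn : ∀ w, 0 ≤ χ w := fun w => Real.smoothTransition.nonneg _
  have χl : ∀ w, χ w ≤ 1 := fun w => Real.smoothTransition.le_one _
  let q : ℝ → ℝ := fun t => (2 * t - 1) * χ (2 * t - 1) + (1 - 2 * t) * χ (1 - 2 * t)
  have hq : ContDiff ℝ ∞ q := by
    simp only [q, χ]
    fun_prop
  refine thinHomotopic_of_reparam (c := γ.toFun) (φ := q) (ψ := fun _ => 1) γ.smooth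
    hq contDiff_const ?_ (fun _ => (hy 1 (by linarith)).symm) (convex_Ioi (1 - ε))
    (convex_Ioi (1 - ε)) hy hy (δ := ε / 2) (by linarith) (fun t ht => ?_) (fun t ht => ?_)
  · intro t
    simp only [SmoothPath.comp, SmoothPath.inv]
    split_ifs with h
    · have e : q t = (1 - 2 * t) * χ (1 - 2 * t) := by simp [q, χ0 (2 * t - 1) (by linarith)]
      rw [e]
      rcases le_total (ε / 2) (1 - 2 * t) with h' | h'
      · rw [χ1 _ h', mul_one]
      · rw [hx _ (by linarith), hx]
        nlinarith [χn (1 - 2 * t), χl (1 - 2 * t)]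
    · have e : q t = (2 * t - 1) * χ (2 * t - 1) := by simp [q, χ0 (1 - 2 * t) (by linarith)]
      rw [e]
      rcases le_total (ε / 2) (2 * t - 1) with h' | h'
      · rw [χ1 _ h', mul_one]
      · rw [hx _ (by linarith), hx]
        nlinarith [χn (2 * t - 1), χl (2 * t - 1)]
  · have e : q t = 1 - 2 * t := by
      simp [q, χ0 (2 * t - 1) (by linarith), χ1 (1 - 2 * t) (by linarith)]
    simp only [Set.mem_Ioi, e]
    constructor <;> linarith
  · have e : q t = 2 * t - 1 := by
      simp [q, χ0 (1 - 2 * t) (by linarith), χ1 (2 * t - 1) (by linarith)]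
    simp only [Set.mem_Ioi, e]
    constructor <;> linarith

theorem inv_comp {x y : M} (γ : SmoothPath n x y) :
    ThinHomotopic (γ.inv.comp γ) (SmoothPath.const n x) := by
  have := comp_inv γ.inv
  rwa [inv_inv] at this

open Classical in
theorem comp_assoc {x y z w : M} (γ₃ : SmoothPath n z w) (γ₂ : SmoothPath n y z)
    (γ₁ : SmoothPath n x y) : ThinHomotopic ((γ₃.comp γ₂).comp γ₁) (γ₃.comp (γ₂.comp γ₁)) := by
  obtain ⟨ε₁, a1, a2, a3, a4⟩ := γ₁.sitting
  obtain ⟨ε₂, b1, b2, b3, b4⟩ := γ₂.sitting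
  obtain ⟨ε₃, c1, c2, c3, c4⟩ := γ₃.sitting
  have hs := step_contDiff
  have hs' := step_contDiff.continuous
  let φ₁ : ℝ × ℝ → ℝ := fun q => (2 + 2 * step q.1) * q.2
  let φ₂ : ℝ × ℝ → ℝ := fun q => 4 * q.2 - (2 - step q.1)
  let φ₃ : ℝ × ℝ → ℝ := fun q => (4 - 2 * step q.1) * q.2 - (3 - 2 * step q.1)
  have k₁ : ContDiff ℝ ∞ φ₁ := by simp only [φ₁]; fun_prop
  have k₂ : ContDiff ℝ ∞ φ₂ := by simp only [φ₂]; fun_prop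
  have k₃ : ContDiff ℝ ∞ φ₃ := by simp only [φ₃]; fun_prop
  have key : ∀ p : ℝ × ℝ, ThinAt n (fun q : ℝ × ℝ => if φ₂ q ≤ 0 then γ₁.toFun (φ₁ q) else
      (fun q : ℝ × ℝ => if φ₂ q - 1 ≤ 0 then γ₂.toFun (φ₂ q) else γ₃.toFun (φ₃ q)) q) p := by
    intro p
    have n1 := step_nonneg p.1
    have n2 := step_le_one p.1
    refine thinAt_glue (m := φ₂) k₂.continuous (thinAt_reparam γ₁.smooth k₁ p)
      (thinAt_glue (m := fun q => φ₂ q - 1) (k₂.continuous.sub continuous_const)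
      (thinAt_reparam γ₂.smooth k₂ p) (thinAt_reparam γ₃.smooth k₃ p) ?_) ?_
    · intro hp
      have e1 : ∀ᶠ q : ℝ × ℝ in nhds p, 1 - ε₂ < φ₂ q :=
        k₂.continuous.continuousAt.eventually_const_lt (by linarith)
      have e2 : ∀ᶠ q : ℝ × ℝ in nhds p, φ₃ q < ε₃ := by
        refine k₃.continuous.continuousAt.eventually_lt_const ?_
        simp only [φ₂, φ₃] at hp ⊢
        have : p.2 = (3 - step p.1) / 4 := by linarith
        rw [this]
        nlinarith
      filter_upwards [e1, e2] with q hq1 hq2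
      rw [b4 _ hq1, c3 _ hq2]
    · intro hp
      have e1 : ∀ᶠ q : ℝ × ℝ in nhds p, 1 - ε₁ < φ₁ q := by
        refine k₁.continuous.continuousAt.eventually_const_lt ?_
        simp only [φ₂, φ₁] at hp ⊢
        have : p.2 = (2 - step p.1) / 4 := by linarith
        rw [this]
        nlinarith
      have e2 : ∀ᶠ q : ℝ × ℝ in nhds p, φ₂ q < ε₂ :=
        k₂.continuous.continuousAt.eventually_lt_const (by linarith)
      have e3 : ∀ᶠ q : ℝ × ℝ in nhds p, φ₂ q < 1 :=
        k₂.continuous.continuousAt.eventually_lt_const (by linarith)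
      filter_upwards [e1, e2, e3] with q hq1 hq2 hq3
      rw [a4 _ hq1, if_pos (by linarith), b3 _ hq2]
  have m1 := min_le_left ε₁ ε₃
  have m2 := min_le_right ε₁ ε₃
  have m0 := lt_min a1 c1
  refine ⟨_, fun p => (key p).smooth, ⟨min ε₁ ε₃ / 4, by linarith, by linarith, ?_, ?_, ?_, ?_⟩,
    fun p => (key p).rank_le_one⟩
  · intro s t ht
    have n1 := step_nonneg s
    have n2 := step_le_one s
    have l2 : φ₂ (s, t) ≤ 0 := by simp only [φ₂]; linarith
    rw [if_pos l2]
    apply a3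
    simp only [φ₁]
    rcases le_total t 0 with h | h
    · nlinarith
    · nlinarith
  · intro s t ht
    have n1 := step_nonneg s
    have n2 := step_le_one s
    have l2 : ¬ φ₂ (s, t) ≤ 0 := by simp only [φ₂]; linarith
    have l3 : ¬ φ₂ (s, t) - 1 ≤ 0 := by simp only [φ₂]; linarith
    rw [if_neg l2]
    dsimp only
    rw [if_neg l3]
    apply c4
    simp only [φ₃]
    rcases le_total t 1 with h | h
    · nlinarith
    · nlinarith
  · intro s t hs
    simp only [SmoothPath.comp, φ₁, φ₂, φ₃, step_zero (s := s) (by linarith)]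
    by_cases l1 : t ≤ 1 / 2
    · rw [if_pos (by linarith), if_pos l1]
      congr 1; ring
    · by_cases l2 : t ≤ 3 / 4
      · rw [if_neg (by linarith), if_pos (by linarith), if_neg l1, if_pos (by linarith)]
        congr 1; ring
      · rw [if_neg (by linarith), if_neg (by linarith), if_neg l1, if_neg (by linarith)]
        congr 1; ring
  · intro s t hs
    simp only [SmoothPath.comp, φ₁, φ₂, φ₃, step_one (s := s) (by linarith)]
    by_cases l1 : t ≤ 1 / 4
    · rw [if_pos (by linarith), if_pos (by linarith), if_pos (by linarith)]
      congr 1; ring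
    · by_cases l2 : t ≤ 1 / 2
      · rw [if_neg (by linarith), if_pos (by linarith), if_pos (by linarith), if_neg (by linarith)]
        congr 1; ring
      · rw [if_neg (by linarith), if_neg (by linarith), if_neg (by linarith)]
        congr 1; ring

/-- The image `f ∘ γ` of a path under a smooth map. -/
def SmoothPath.map {d : ℕ} {Y : Type w} [TopologicalSpace Y]
    [ChartedSpace (EuclideanSpace ℝ (Fin d)) Y] {f : Y → M} (hf : ContMDiff (𝓡 d) (𝓡 n) ∞ f)
    {x y : Y} (γ : SmoothPath d x y) : SmoothPath n (f x) (f y) where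
  toFun t := f (γ.toFun t)
  smooth := hf.comp γ.smooth
  sitting := by
    obtain ⟨ε, h0, h1, hx, hy⟩ := γ.sitting
    exact ⟨ε, h0, h1, fun t ht => by rw [hx t ht], fun t ht => by rw [hy t ht]⟩

theorem rank_comp_le_rank' {V V' V'' : Type} [AddCommGroup V] [Module ℝ V] [TopologicalSpace V]
    [AddCommGroup V'] [Module ℝ V'] [TopologicalSpace V'] [AddCommGroup V''] [Module ℝ V'']
    [TopologicalSpace V''] (g : V' →L[ℝ] V'') (f : V →L[ℝ] V') :
    LinearMap.rank (g.comp f).toLinearMap ≤ LinearMap.rank f.toLinearMap :=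
  LinearMap.rank_comp_le_right f.toLinearMap g.toLinearMap

theorem map_congr {d : ℕ} {Y : Type w} [TopologicalSpace Y]
    [ChartedSpace (EuclideanSpace ℝ (Fin d)) Y] {f : Y → M} (hf : ContMDiff (𝓡 d) (𝓡 n) ∞ f)
    {x y : Y} {γ γ' : SmoothPath d x y} (H : ThinHomotopic γ γ') :
    ThinHomotopic (γ.map hf) (γ'.map hf) := by
  obtain ⟨h, H⟩ := H
  obtain ⟨ε, h0, h1, ha, hb, hc, hd⟩ := H.sitting
  refine ⟨f ∘ h, hf.comp H.smooth, ⟨ε, h0, h1, fun s t ht => by simp [ha s t ht],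
    fun s t ht => by simp [hb s t ht], fun s t hs => by simp [hc s t hs, SmoothPath.map],
    fun s t hs => by simp [hd s t hs, SmoothPath.map]⟩, fun p => ?_⟩
  rw [mfderiv_comp (I := 𝓘(ℝ, ℝ × ℝ)) (I' := 𝓡 d) (I'' := 𝓡 n) p
    ((hf (h p)).mdifferentiableAt (by simp)) ((H.smooth p).mdifferentiableAt (by simp))]
  exact (rank_comp_le_rank' (mfderiv (𝓡 d) (𝓡 n) f (h p))
    (mfderiv 𝓘(ℝ, ℝ × ℝ) (𝓡 d) h p)).trans (H.rank_le_one p)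

end Paths

/-! ## The path groupoid -/

/-- The set of objects of the path groupoid of the `n`-dimensional manifold `M`: the points of `M`. -/
structure PathGroupoid (n : ℕ) (M : Type u) where
  pt : M

/-- The path groupoid: morphisms are thin homotopy classes of paths. -/
instance PathGroupoid.groupoid (n : ℕ) (M : Type u) [TopologicalSpace M]
    [ChartedSpace (EuclideanSpace ℝ (Fin n)) M] : Groupoid (PathGroupoid n M) where
  Hom a b := _root_.Quotient (thinSetoid n a.pt b.pt)
  id a := _root_.Quotient.mk _ (SmoothPath.const n a.pt)
  comp {a b c} f g := _root_.Quotient.map₂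
    (fun (γ₁ : SmoothPath n a.pt b.pt) (γ₂ : SmoothPath n b.pt c.pt) => γ₂.comp γ₁)
    (fun _ _ H _ _ K => comp_congr K H) f g
  inv {a b} f := _root_.Quotient.map (fun γ : SmoothPath n a.pt b.pt => γ.inv)
    (fun _ _ H => inv_congr H) f
  id_comp f := _root_.Quotient.inductionOn f fun γ => _root_.Quotient.sound (comp_const γ)
  comp_id f := _root_.Quotient.inductionOn f fun γ => _root_.Quotient.sound (const_comp γ)
  assoc f g h := _root_.Quotient.inductionOn₃ f g h fun γ₁ γ₂ γ₃ =>
    _root_.Quotient.sound (comp_assoc γ₃ γ₂ γ₁).symm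
  inv_comp f := _root_.Quotient.inductionOn f fun γ => _root_.Quotient.sound (comp_inv γ)
  comp_inv f := _root_.Quotient.inductionOn f fun γ => _root_.Quotient.sound (inv_comp γ)

section Groupoid

variable {n : ℕ} {M : Type u} [TopologicalSpace M] [ChartedSpace (EuclideanSpace ℝ (Fin n)) M]

/-- The thin homotopy class of a path, as a morphism of the path groupoid. -/
def pathClass {x y : M} (γ : SmoothPath n x y) :
    (⟨x⟩ : PathGroupoid n M) ⟶ (⟨y⟩ : PathGroupoid n M) :=
  (_root_.Quotient.mk (thinSetoid n x y) γ : _root_.Quotient (thinSetoid n x y))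

/-- The functor `f_*` between path groupoids induced by a smooth map `f`. -/
def pathMap {d : ℕ} {Y : Type w} [TopologicalSpace Y]
    [ChartedSpace (EuclideanSpace ℝ (Fin d)) Y] {f : Y → M} (hf : ContMDiff (𝓡 d) (𝓡 n) ∞ f) :
    PathGroupoid d Y ⥤ PathGroupoid n M where
  obj a := ⟨f a.pt⟩
  map {a b} g := _root_.Quotient.map (fun γ : SmoothPath d a.pt b.pt => γ.map hf)
    (fun _ _ H => map_congr hf H) g
  map_id _ := rfl
  map_comp g h := _root_.Quotient.inductionOn₂ g h fun γ₁ γ₂ => by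
    refine congrArg (_root_.Quotient.mk _) ?_
    simp only [SmoothPath.map, SmoothPath.comp]
    congr 1
    funext t
    split_ifs <;> rfl

/-- The thin homotopy group of `M` at `x`: the endomorphisms of `x` in the path groupoid, with
composition as multiplication (`a * b` is `b` followed by `a`). -/
abbrev ThinHomotopyGroup (n : ℕ) {M : Type u} [TopologicalSpace M]
    [ChartedSpace (EuclideanSpace ℝ (Fin n)) M] (x : M) : Type u :=
  End (⟨x⟩ : PathGroupoid n M)

/-- A family of paths `c(u)`, `u ∈ U ⊆ ℝ^m`, is smooth if `(u, t) ↦ c(u)(t)` is smooth on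
`U × [0,1]`. (The family is given for all `u`, but only its values for `u ∈ U` matter.) -/
def IsSmoothFamily {m : ℕ} (U : Set (EuclideanSpace ℝ (Fin m))) {a b : EuclideanSpace ℝ (Fin m) → M}
    (c : ∀ u, SmoothPath n (a u) (b u)) : Prop :=
  ContMDiffOn 𝓘(ℝ, EuclideanSpace ℝ (Fin m) × ℝ) (𝓡 n) ∞ (fun p => (c p.1).toFun p.2)
    (U ×ˢ Set.Icc (0 : ℝ) 1)

end Groupoid

/-! ## Torsors over a Lie group -/

/-- An object of `G-Tor`: a smooth manifold (Hausdorff, second countable) with a smooth, free and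
transitive right action of `G`. Following Mathlib, `MulOpposite.op g • p` is the right action
`p · g`. -/
structure GTor (k : ℕ) (G : Type w) [Group G] [TopologicalSpace G]
    [ChartedSpace (EuclideanSpace ℝ (Fin k)) G] where
  carrier : Type w
  dim : ℕ
  [topology : TopologicalSpace carrier]
  [charts : ChartedSpace (EuclideanSpace ℝ (Fin dim)) carrier]
  [isManifold : IsManifold (𝓡 dim) ∞ carrier]
  [hausdorff : T2Space carrier]
  [secondCountable : SecondCountableTopology carrier]
  [action : MulAction Gᵐᵒᵖ carrier]
  smooth_action : ContMDiff ((𝓡 dim).prod (𝓡 k)) (𝓡 dim) ∞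
    (fun p : carrier × G => MulOpposite.op p.2 • p.1)
  nonempty : Nonempty carrier
  free : ∀ (p : carrier) (g : G), MulOpposite.op g • p = p → g = 1
  transitive : ∀ p q : carrier, ∃ g : G, MulOpposite.op g • p = q

attribute [instance] GTor.topology GTor.charts GTor.isManifold GTor.hausdorff
  GTor.secondCountable GTor.action

/-- A morphism of `G-Tor`: a smooth equivariant map. -/
@[ext]
structure GTor.Hom {k : ℕ} {G : Type w} [Group G] [TopologicalSpace G]
    [ChartedSpace (EuclideanSpace ℝ (Fin k)) G] (P Q : GTor k G) where
  toFun : P.carrier → Q.carrier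
  smooth : ContMDiff (𝓡 P.dim) (𝓡 Q.dim) ∞ toFun
  equivariant : ∀ (p : P.carrier) (g : G),
    toFun (MulOpposite.op g • p) = MulOpposite.op g • toFun p

/-- The category `G-Tor`. -/
instance GTor.category (k : ℕ) (G : Type w) [Group G] [TopologicalSpace G]
    [ChartedSpace (EuclideanSpace ℝ (Fin k)) G] : Category (GTor k G) where
  Hom P Q := GTor.Hom P Q
  id P := ⟨id, contMDiff_id, fun _ _ => rfl⟩
  comp f g := ⟨g.toFun ∘ f.toFun, g.smooth.comp f.smooth, fun p a => by
    simp [f.equivariant, g.equivariant]⟩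

section LieGroups

variable {n k : ℕ} {M : Type u} [TopologicalSpace M] [ChartedSpace (EuclideanSpace ℝ (Fin n)) M]
  {G : Type w} [Group G] [TopologicalSpace G] [ChartedSpace (EuclideanSpace ℝ (Fin k)) G]

/-- The Lie group `G` as a right torsor over itself. -/
def selfTorsor (k : ℕ) (G : Type w) [Group G] [TopologicalSpace G]
    [ChartedSpace (EuclideanSpace ℝ (Fin k)) G] [LieGroup (𝓡 k) ∞ G] [T2Space G]
    [SecondCountableTopology G] : GTor k G where
  carrier := G
  dim := k
  isManifold := (inferInstance : ContMDiffMul (𝓡 k) ∞ G).toIsManifold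
  smooth_action := contMDiff_mul (𝓡 k) ∞
  nonempty := ⟨1⟩
  free p g h := by simpa using h
  transitive p q := ⟨p⁻¹ * q, by simp⟩

/-- Left multiplication by `g`, a smooth equivariant map `G → G`. -/
def leftMul (k : ℕ) (G : Type w) [Group G] [TopologicalSpace G]
    [ChartedSpace (EuclideanSpace ℝ (Fin k)) G] [LieGroup (𝓡 k) ∞ G] [T2Space G]
    [SecondCountableTopology G] (g : G) : GTor.Hom (selfTorsor k G) (selfTorsor k G) where
  toFun := fun a : G => g * a
  smooth := contMDiff_mul_left (I := 𝓡 k) (a := g)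
  equivariant p a := (mul_assoc (G := G) g p a).symm

/-- The functor `i_G : BG → G-Tor`: the only object of `BG` (the one-object groupoid `SingleObj G`,
in which `g₂ ∘ g₁ = g₂ * g₁`) goes to `G`, and `g` goes to left multiplication by `g`. -/
def iG (k : ℕ) (G : Type w) [Group G] [TopologicalSpace G]
    [ChartedSpace (EuclideanSpace ℝ (Fin k)) G] [LieGroup (𝓡 k) ∞ G] [T2Space G]
    [SecondCountableTopology G] : SingleObj G ⥤ GTor k G where
  obj _ := selfTorsor k G
  map g := leftMul k G g
  map_id _ := GTor.Hom.ext (funext fun a => one_mul (M := G) a)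
  map_comp f g := GTor.Hom.ext (funext fun a => mul_assoc (G := G) g f a)

/-- The identification `Mor(G, G) = G` for the torsor `G`: the group element `g` corresponds to left
multiplication by `g`, that is, to `i_G(g)`; conversely `f` corresponds to `f(1)`. -/
def endEquiv (k : ℕ) (G : Type w) [Group G] [TopologicalSpace G]
    [ChartedSpace (EuclideanSpace ℝ (Fin k)) G] [LieGroup (𝓡 k) ∞ G] [T2Space G]
    [SecondCountableTopology G] : End ((iG k G).obj (SingleObj.star G)) ≃* G where
  toFun f := GTor.Hom.toFun f (1 : G)
  invFun g := (iG k G).map (SingleObj.toEnd G g)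
  left_inv f := GTor.Hom.ext (funext fun a => by
    have h := GTor.Hom.equivariant f (1 : G) (show G from a)
    exact h.symm.trans (congrArg (GTor.Hom.toFun f) (one_mul (M := G) a)))
  right_inv g := mul_one g
  map_mul' f g := by
    have h := GTor.Hom.equivariant f (1 : G) (show G from GTor.Hom.toFun g (1 : G))
    exact (congrArg (GTor.Hom.toFun f) (one_mul (M := G) (GTor.Hom.toFun g (1 : G)))).symm.trans h

/-! ## Transport functors with `BG`-structure -/

/-- Smoothness of a functor `P₁(M) → BG`: it maps smooth families of paths to smooth functions.
(On objects there is no condition, since `BG` has a single object.) -/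
def IsSmoothFunctor (k : ℕ) {G : Type w} [Group G] [TopologicalSpace G]
    [ChartedSpace (EuclideanSpace ℝ (Fin k)) G] (F : PathGroupoid n M ⥤ SingleObj G) : Prop :=
  ∀ (m : ℕ) (U : Set (EuclideanSpace ℝ (Fin m))), IsOpen U →
    ∀ (a b : EuclideanSpace ℝ (Fin m) → M) (c : ∀ u, SmoothPath n (a u) (b u)),
      IsSmoothFamily U c →
        ContMDiffOn (𝓡 m) (𝓡 k) ∞ (fun u => (F.map (pathClass (c u)) : G)) U

variable [LieGroup (𝓡 k) ∞ G] [T2Space G] [SecondCountableTopology G]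

/-- A `π`-local `i_G`-trivialization of a functor `tra : P₁(M) → G-Tor`: a functor
`triv : P₁(Y) → BG` with a natural equivalence `t : π^* tra → i_G ∘ triv`. -/
structure LocalTrivialization {d : ℕ} {Y : Type u} [TopologicalSpace Y]
    [ChartedSpace (EuclideanSpace ℝ (Fin d)) Y] {π : Y → M} (hπ : ContMDiff (𝓡 d) (𝓡 n) ∞ π)
    (tra : PathGroupoid n M ⥤ GTor k G) where
  triv : PathGroupoid d Y ⥤ SingleObj G
  t : pathMap hπ ⋙ tra ≅ triv ⋙ iG k G

/-- The component `t(y₂) ∘ t(y₁)⁻¹` at `(y₁, y₂) ∈ Y ×_M Y` of the natural equivalence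
`g = π₂^* t ∘ π₁^* t⁻¹`. -/
def LocalTrivialization.transition {d : ℕ} {Y : Type u} [TopologicalSpace Y]
    [ChartedSpace (EuclideanSpace ℝ (Fin d)) Y] {π : Y → M} {hπ : ContMDiff (𝓡 d) (𝓡 n) ∞ π}
    {tra : PathGroupoid n M ⥤ GTor k G} (L : LocalTrivialization hπ tra) (y₁ y₂ : Y)
    (h : π y₁ = π y₂) :
    (iG k G).obj (L.triv.obj ⟨y₁⟩) ⟶ (iG k G).obj (L.triv.obj ⟨y₂⟩) :=
  L.t.inv.app ⟨y₁⟩ ≫ eqToHom (congrArg (fun m : M => tra.obj ⟨m⟩) h) ≫ L.t.hom.app ⟨y₂⟩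

/-- The descent data `(triv, g)` are smooth: `triv` is a smooth functor, and `g(α) = i_G(g'(α))` for
a smooth function `g'` on the submanifold `Y ×_M Y` of `Y × Y`. (Such a `g'` is automatically
natural, because `g` is natural and `i_G` is faithful.) -/
def LocalTrivialization.HasSmoothDescentData {d : ℕ} {Y : Type u} [TopologicalSpace Y]
    [ChartedSpace (EuclideanSpace ℝ (Fin d)) Y] {π : Y → M} {hπ : ContMDiff (𝓡 d) (𝓡 n) ∞ π}
    {tra : PathGroupoid n M ⥤ GTor k G} (L : LocalTrivialization hπ tra) : Prop :=
  IsSmoothFunctor k L.triv ∧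
    ∃ g' : Y × Y → G,
      ContMDiffOn ((𝓡 d).prod (𝓡 d)) (𝓡 k) ∞ g' {α | π α.1 = π α.2} ∧
      ∀ (y₁ y₂ : Y) (h : π y₁ = π y₂), L.transition y₁ y₂ h = (iG k G).map (g' (y₁, y₂) : G)

/-- A transport functor on `M` in `G-Tor` with `BG`-structure: for some surjective submersion
`π : Y → M` there is a `π`-local `i_G`-trivialization with smooth descent data. -/
def IsTransportFunctor (tra : PathGroupoid n M ⥤ GTor k G) : Prop :=
  ∃ (d : ℕ) (Y : Type u) (_ : TopologicalSpace Y)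
    (_ : ChartedSpace (EuclideanSpace ℝ (Fin d)) Y) (_ : IsManifold (𝓡 d) ∞ Y)
    (_ : T2Space Y) (_ : SecondCountableTopology Y) (π : Y → M)
    (hπ : Manifold.IsSubmersion (𝓡 d) (𝓡 n) ∞ π) (_ : Function.Surjective π)
    (L : LocalTrivialization hπ.contMDiff tra), L.HasSmoothDescentData

/-! ## Holonomy maps -/

/-- A holonomy map on `M` at `x`: a group homomorphism from the thin homotopy group to `G` that
maps smooth families of loops at `x` to smooth functions. -/
structure IsHolonomyMap (k : ℕ) {G : Type w} [Group G] [TopologicalSpace G]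
    [ChartedSpace (EuclideanSpace ℝ (Fin k)) G] {x : M} (H : ThinHomotopyGroup n x → G) : Prop where
  map_mul : ∀ a b : ThinHomotopyGroup n x, H (a * b) = H a * H b
  smooth : ∀ (m : ℕ) (U : Set (EuclideanSpace ℝ (Fin m))), IsOpen U →
    ∀ c : EuclideanSpace ℝ (Fin m) → SmoothPath n x x, IsSmoothFamily U c →
      ContMDiffOn (𝓡 m) (𝓡 k) ∞ (fun u => H (pathClass (c u))) U

/-- The restriction `tra_{x,x}` of a functor `tra` to the thin homotopy group at `x`, with values in
`G` by means of an identification `φ` of the fibre over `x` with the torsor `G`. -/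
def loopRestriction (tra : PathGroupoid n M ⥤ GTor k G) (x : M)
    (φ : tra.obj ⟨x⟩ ≅ (iG k G).obj (SingleObj.star G)) (γ : ThinHomotopyGroup n x) : G :=
  endEquiv k G (φ.inv ≫ tra.map γ ≫ φ.hom)

end LieGroups

end

end PathTransport

/-! The homomorphism property is formal: `tra` is a functor, and conjugation by `φ` respects
composition. The content is smoothness, which is known only for `triv` on paths in `Y`, while a loop
in `M` need not lift to `Y`. The remedy is to cut each loop into pieces that do lift.

Fix `u₀`. A submersion has local sections (`exists_local_section`), so near each time `t₀` the paths
`c u`, for `u` near `u₀`, run inside the domain of one section `σ`, and `σ ∘ c u` is a smooth family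
of lifts. Naturality of the trivialization expresses transport along such a piece as `triv` of the
lift (`map_comp_frame`), which is smooth in `u`. Lifts of neighbouring pieces do not match at their
ends; the mismatch is the transition function `g'` at a pair of points of `Y` in the same fibre,
again smooth in `u` (`frame_change`). Transport up to time `t` is thus a product of smooth factors,
provided the frame over `c u t` comes from a point of `Y` depending smoothly on `u`.

No explicit subdivision is chosen. Smoothness of transport up to time `s` and up to time `t` are
equivalent for `s`, `t` in a common short interval (`SmoothTransportNear.step`), and connectedness
of `[0,1]` carries the property from `0` to `1` (`smoothTransportNear_one`). At time `1` the frame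
still varies with `u`, but over the fixed point `x`; one more transition function compares it with a
constant frame, and a constant conjugation compares that one with `φ` (`loopRestriction_eq`). -/

namespace PathTransport

noncomputable section

/-! ### Local sections of submersions -/

/-- A submersion has a smooth local section through every point. -/
theorem exists_local_section {n d : ℕ} {M : Type u} [TopologicalSpace M]
    [ChartedSpace (EuclideanSpace ℝ (Fin n)) M] [IsManifold (𝓡 n) ∞ M] {Y : Type u}
    [TopologicalSpace Y] [ChartedSpace (EuclideanSpace ℝ (Fin d)) Y] [IsManifold (𝓡 d) ∞ Y]
    {π : Y → M} {y : Y} (h : Manifold.IsSubmersionAt (𝓡 d) (𝓡 n) ∞ π y) :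
    ∃ (V : Set M) (σ : M → Y), IsOpen V ∧ π y ∈ V ∧ ContMDiffOn (𝓡 n) (𝓡 d) ∞ σ V ∧
      ∀ z ∈ V, π (σ z) = z := by
  let f := h.domChart
  let g := h.codChart
  let e := h.equiv
  let v := (e (f y)).2
  have hf : y ∈ f.source := h.mem_domChart_source
  have hg : π y ∈ g.source := h.mem_codChart_source
  have hw : ∀ a ∈ f.target, g (π (f.symm a)) = (e a).1 := fun a ha => by
    have := h.writtenInCharts (show a ∈ (h.domChart.extend (𝓡 d)).target by simpa [f] using ha)
    simpa [f, g, e] using this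
  -- In these charts `π` is the first projection after `e`. Freezing the complementary coordinate at
  -- its value `v` for `y` gives a right inverse through `f y`.
  let s : EuclideanSpace ℝ (Fin n) → EuclideanSpace ℝ (Fin d) := fun a => e.symm (a, v)
  have hs : ContDiff ℝ ∞ s := by
    simp only [s]
    fun_prop
  refine ⟨g.source ∩ g ⁻¹' (s ⁻¹' f.target), fun z => f.symm (s (g z)),
    g.isOpen_inter_preimage (f.open_target.preimage hs.continuous), ⟨hg, ?_⟩, ?_, ?_⟩
  · have h1 := hw (f y) (f.map_source hf)
    rw [f.left_inv hf] at h1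
    have h2 : s (g (π y)) = f y := by simp [s, h1, v]
    simpa [h2] using f.map_source hf
  · have hfs := contMDiffOn_symm_of_mem_maximalAtlas h.domChart_mem_maximalAtlas
    have hgs := contMDiffOn_of_mem_maximalAtlas h.codChart_mem_maximalAtlas
    exact hfs.comp ((hs.contMDiff.comp_contMDiffOn hgs).mono Set.inter_subset_left)
      fun z hz => hz.2
  · rintro z ⟨hz, hz'⟩
    have h1 := hw _ hz'
    have h2 : f.symm (s (g z)) ∈ f.source := f.map_target hz'
    refine g.injOn (h.source_subset_preimage_source h2) hz ?_
    simpa [s] using h1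

/-! ### Pieces of a path and their concatenation -/

section Segments

variable {n : ℕ} {M : Type u} [TopologicalSpace M] [ChartedSpace (EuclideanSpace ℝ (Fin n)) M]

/-- The curve `γ` run from parameter `a` to parameter `b`, with sitting instants. -/
def segment {γ : ℝ → M} (hγ : ContMDiff 𝓘(ℝ, ℝ) (𝓡 n) ∞ γ) (a b : ℝ) :
    SmoothPath n (γ a) (γ b) where
  toFun t := γ (a + (b - a) * step t)
  smooth := by
    have := step_contDiff
    exact hγ.comp (ContDiff.contMDiff (by fun_prop))
  sitting := ⟨1 / 4, by norm_num, by norm_num, fun t ht => by simp [step_zero ht],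
    fun t ht => by simp [step_one ht]⟩

theorem SmoothPath.apply_zero {x y : M} (γ : SmoothPath n x y) : γ.toFun 0 = x := by
  obtain ⟨ε, h0, -, hx, -⟩ := γ.sitting
  exact hx 0 h0

theorem SmoothPath.apply_one {x y : M} (γ : SmoothPath n x y) : γ.toFun 1 = y := by
  obtain ⟨ε, h0, -, -, hy⟩ := γ.sitting
  exact hy 1 (by linarith)

/-- The part of a path up to the parameter `b`. -/
def SmoothPath.initial {x y : M} (γ : SmoothPath n x y) (b : ℝ) : SmoothPath n x (γ.toFun b) where
  toFun t := γ.toFun (b * step t)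
  smooth := by
    have := step_contDiff
    exact γ.smooth.comp (ContDiff.contMDiff (by fun_prop))
  sitting := ⟨1 / 4, by norm_num, by norm_num, fun t ht => by simp [step_zero ht, γ.apply_zero],
    fun t ht => by simp [step_one ht]⟩

/-- Both sides run along the single curve `γ`, with parameters going from `0` to `b`, so
interpolating the parameters sweeps out no area. The order of `a` and `b` plays no role:
backtracking is thin, which lets transport be propagated backwards in time as well. -/
theorem segment_comp_initial {x y : M} (γ : SmoothPath n x y) (a b : ℝ) :
    ThinHomotopic ((segment γ.smooth a b).comp (γ.initial a)) (γ.initial b) := by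
  have := step_contDiff
  -- Both reparametrizations are exactly constant near the ends, so singletons serve as the convex
  -- sets. With `δ = 1/8`, every `step` that occurs is `0` for `t < δ` and `1` for `1 - δ < t`.
  refine thinHomotopic_of_reparam (c := γ.toFun)
    (φ := fun t => a * step (2 * t) + (b - a) * step (2 * t - 1)) (ψ := fun t => b * step t)
    γ.smooth (by fun_prop) (by fun_prop) (fun t => ?_) (fun _ => rfl)
    (convex_singleton 0) (convex_singleton b) (fun r hr => ?_) (fun r hr => ?_)
    (δ := 1 / 8) (by norm_num) (fun t ht => ?_) (fun t ht => ?_)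
  · simp only [SmoothPath.comp, SmoothPath.initial, segment]
    split_ifs with h
    · simp [step_zero (s := 2 * t - 1) (by linarith)]
    · simp [step_one (s := 2 * t) (by linarith)]
  · rw [Set.mem_singleton_iff.1 hr, γ.apply_zero]
  · rw [Set.mem_singleton_iff.1 hr]
  · simp [step_zero (s := 2 * t) (by linarith), step_zero (s := 2 * t - 1) (by linarith),
      step_zero (s := t) (by linarith)]
  · simp [step_one (s := 2 * t) (by linarith), step_one (s := 2 * t - 1) (by linarith),
      step_one (s := t) (by linarith)]

/-- The path `γ.initial 1` ends at `γ.toFun 1`, which equals `y` only propositionally; `γ'` is a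
copy of it with the right endpoint. -/
theorem thinHomotopic_initial_one {x y : M} (γ : SmoothPath n x y) {γ' : SmoothPath n x y}
    (h : ∀ t, γ'.toFun t = (γ.initial 1).toFun t) : ThinHomotopic γ γ' := by
  obtain ⟨ε, h0, h1, hx, hy⟩ := γ.sitting
  refine thinHomotopic_of_reparam (c := γ.toFun) (φ := id) (ψ := step) γ.smooth contDiff_id
    step_contDiff (fun _ => rfl) (fun t => by simp [h, SmoothPath.initial]) (convex_Iio ε)
    (convex_Ioi (1 - ε)) hx hy (δ := min ε (1 / 4)) (by positivity) (fun t ht => ?_)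
    (fun t ht => ?_)
  · rw [lt_min_iff] at ht
    simp [step_zero ht.2, h0, ht.1]
  · have m1 := min_le_left ε (1 / 4)
    have m2 := min_le_right ε (1 / 4)
    rw [step_one (by linarith)]
    exact ⟨show 1 - ε < t by linarith, show 1 - ε < 1 by linarith⟩

theorem pathClass_eq {x y : M} {γ γ' : SmoothPath n x y} (h : ThinHomotopic γ γ') :
    pathClass γ = pathClass γ' :=
  _root_.Quotient.sound h

theorem pathClass_comp {x y z : M} (γ₂ : SmoothPath n y z) (γ₁ : SmoothPath n x y) :
    pathClass (γ₂.comp γ₁) = pathClass γ₁ ≫ pathClass γ₂ :=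
  rfl

theorem SmoothPath.ext_toFun {x y : M} {γ γ' : SmoothPath n x y}
    (h : ∀ t, γ.toFun t = γ'.toFun t) : γ = γ' := by
  cases γ
  cases γ'
  congr
  exact funext h

end Segments

/-! ### Frames of the fibres and transport expressed in them -/

section Frames

variable {n k d : ℕ} {M : Type u} [TopologicalSpace M] [ChartedSpace (EuclideanSpace ℝ (Fin n)) M]
  {G : Type w} [Group G] [TopologicalSpace G] [ChartedSpace (EuclideanSpace ℝ (Fin k)) G]
  [LieGroup (𝓡 k) ∞ G] [T2Space G] [SecondCountableTopology G]
  {Y : Type u} [TopologicalSpace Y] [ChartedSpace (EuclideanSpace ℝ (Fin d)) Y] {π : Y → M}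
  {hπ : ContMDiff (𝓡 d) (𝓡 n) ∞ π} {tra : PathGroupoid n M ⥤ GTor k G}

/-- The identification of the fibre over `π y` with `G` given by the trivialization. -/
def LocalTrivialization.fiberIso (L : LocalTrivialization hπ tra) (y : Y) :
    tra.obj ⟨π y⟩ ≅ selfTorsor k G :=
  L.t.app ⟨y⟩

/-- The identification of the fibre over `z` with `G` given by a point `y` over `z`. -/
def LocalTrivialization.frame (L : LocalTrivialization hπ tra) (y : Y) {z : M} (h : π y = z) :
    tra.obj ⟨z⟩ ≅ selfTorsor k G :=
  eqToIso (congrArg (fun m : M => tra.obj ⟨m⟩) h.symm) ≪≫ L.fiberIso y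

theorem LocalTrivialization.frame_rfl (L : LocalTrivialization hπ tra) (y : Y) :
    L.frame y rfl = L.fiberIso y := by
  simp [frame]

/-- The group element `g`, as an automorphism of the torsor `G`. -/
def leftMulHom (k : ℕ) {G : Type w} [Group G] [TopologicalSpace G]
    [ChartedSpace (EuclideanSpace ℝ (Fin k)) G] [LieGroup (𝓡 k) ∞ G] [T2Space G]
    [SecondCountableTopology G] (g : G) : selfTorsor k G ⟶ selfTorsor k G :=
  leftMul k G g

theorem leftMulHom_one : leftMulHom k (1 : G) = 𝟙 _ :=
  (iG k G).map_id (SingleObj.star G)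

/-- The product is reversed because `≫` applies its left factor first; hence later pieces of a
transport multiply on the left. -/
theorem leftMulHom_comp (g h : G) : leftMulHom k g ≫ leftMulHom k h = leftMulHom k (h * g) :=
  ((iG k G).map_comp (X := SingleObj.star G) (Y := SingleObj.star G) (Z := SingleObj.star G)
    g h).symm

/-- The transition is `t(y₂) ∘ t(y₁)⁻¹`, so composing it with `t(y₁)` cancels the inverse. This
measures the jump between lifts that end and start at different points of one fibre. -/
theorem LocalTrivialization.frame_change (L : LocalTrivialization hπ tra) {g' : Y × Y → G}
    (hg' : ∀ (y₁ y₂ : Y) (h : π y₁ = π y₂),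
      L.transition y₁ y₂ h = (iG k G).map (g' (y₁, y₂) : G))
    {y₁ y₂ : Y} {z : M} (h₁ : π y₁ = z) (h₂ : π y₂ = z) :
    (L.frame y₂ h₂).hom = (L.frame y₁ h₁).hom ≫ leftMulHom k (g' (y₁, y₂)) := by
  subst h₁
  have := hg' y₁ y₂ h₂.symm
  change (L.fiberIso y₁).inv ≫ eqToHom (congrArg (fun m : M => tra.obj ⟨m⟩) h₂.symm) ≫
    (L.fiberIso y₂).hom = leftMulHom k (g' (y₁, y₂)) at this
  rw [← this, frame_rfl, Iso.hom_inv_id_assoc]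
  simp [frame]

/-- This is naturality of `t` at the class of `δ`: once a path lifts to `Y`, its transport read in
the frames at the ends of the lift is `triv` of the lift. -/
theorem LocalTrivialization.map_comp_frame (L : LocalTrivialization hπ tra) {y₀ y₁ : Y} {z₀ z₁ : M}
    (δ : SmoothPath d y₀ y₁) (γ : SmoothPath n z₀ z₁) (h₀ : π y₀ = z₀) (h₁ : π y₁ = z₁)
    (h : ∀ t, π (δ.toFun t) = γ.toFun t) :
    tra.map (pathClass γ) ≫ (L.frame y₁ h₁).hom =
      (L.frame y₀ h₀).hom ≫ leftMulHom k (L.triv.map (pathClass δ) : G) := by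
  subst h₀ h₁
  obtain rfl : δ.map hπ = γ := SmoothPath.ext_toFun h
  rw [frame_rfl, frame_rfl]
  exact L.t.hom.naturality (pathClass δ)

/-- Stopping at time `1` only reparametrizes the path. The endpoint is generalized to a variable `w`
so that `z = w` can be substituted despite the dependent types. -/
theorem LocalTrivialization.map_comp_frame_initial_one (L : LocalTrivialization hπ tra) {y : Y}
    {x z : M} (γ : SmoothPath n x z) (h : π y = z) (h' : π y = γ.toFun 1) :
    tra.map (pathClass γ) ≫ (L.frame y h).hom =
      tra.map (pathClass (γ.initial 1)) ≫ (L.frame y h').hom := by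
  suffices H : ∀ (w : M) (γ' : SmoothPath n x w) (hw : π y = w),
      (∀ t, γ'.toFun t = (γ.initial 1).toFun t) → tra.map (pathClass γ) ≫ (L.frame y h).hom =
        tra.map (pathClass γ') ≫ (L.frame y hw).hom from H _ _ h' fun _ => rfl
  intro w γ' hw e
  obtain rfl : z = w := h.symm.trans hw
  rw [pathClass_eq (thinHomotopic_initial_one γ e)]

/-- One stage of the product formula: `a` is the transport up to `s` in the frame at `y`, `g` passes
from `y` to the starting point `y₁` of the lift `δ`, and `triv` of `δ` carries the result on to time
`t`. -/
theorem LocalTrivialization.map_comp_frame_initial (L : LocalTrivialization hπ tra)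
    {x z : M} (γ : SmoothPath n x z) {s t : ℝ} {y₀ y₁ y₂ : Y} {a b g : G}
    (δ : SmoothPath d y₁ y₂) (hδ : ∀ r, π (δ.toFun r) = (segment γ.smooth s t).toFun r)
    (h₀ : π y₀ = x) {y : Y} (h : π y = γ.toFun s) (h₁ : π y₁ = γ.toFun s) (h₂ : π y₂ = γ.toFun t)
    (ha : tra.map (pathClass (γ.initial s)) ≫ (L.frame y h).hom =
      (L.frame y₀ h₀).hom ≫ leftMulHom k a)
    (hg : (L.frame y₁ h₁).hom = (L.frame y h).hom ≫ leftMulHom k g)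
    (hb : b = (L.triv.map (pathClass δ) : G) * (g * a)) :
    tra.map (pathClass (γ.initial t)) ≫ (L.frame y₂ h₂).hom =
      (L.frame y₀ h₀).hom ≫ leftMulHom k b := by
  rw [← pathClass_eq (segment_comp_initial γ s t), pathClass_comp, tra.map_comp, Category.assoc,
    L.map_comp_frame δ _ h₁ h₂ hδ, hg, ← Category.assoc, ← Category.assoc, ha, Category.assoc,
    Category.assoc, leftMulHom_comp, leftMulHom_comp, hb, mul_assoc]

theorem leftMulHom_endEquiv (f : selfTorsor k G ⟶ selfTorsor k G) :
    leftMulHom k (endEquiv k G f) = f :=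
  (endEquiv k G).left_inv f

theorem endEquiv_leftMulHom (g : G) : endEquiv k G (leftMulHom k g) = g :=
  (endEquiv k G).right_inv g

/-! ### Smooth dependence of transport on the parameter -/

/-- Near the parameter `u₀`, parallel transport along the family `c` up to the time `t`, expressed in
frames that depend smoothly on the parameter, is smooth. -/
def LocalTrivialization.SmoothTransportNear (L : LocalTrivialization hπ tra) {m : ℕ}
    (U : Set (EuclideanSpace ℝ (Fin m))) {x z : M}
    (c : EuclideanSpace ℝ (Fin m) → SmoothPath n x z) {y₀ : Y} (h₀ : π y₀ = x)
    (u₀ : EuclideanSpace ℝ (Fin m)) (t : ℝ) : Prop :=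
  ∃ (W : Set (EuclideanSpace ℝ (Fin m))) (y : EuclideanSpace ℝ (Fin m) → Y)
    (q : EuclideanSpace ℝ (Fin m) → G), IsOpen W ∧ u₀ ∈ W ∧ W ⊆ U ∧
    ContMDiffOn (𝓡 m) (𝓡 d) ∞ y W ∧ ContMDiffOn (𝓡 m) (𝓡 k) ∞ q W ∧
    ∀ u ∈ W, ∃ h : π (y u) = (c u).toFun t,
      tra.map (pathClass ((c u).initial t)) ≫ (L.frame (y u) h).hom =
        (L.frame y₀ h₀).hom ≫ leftMulHom k (q u)

/-- Up to time `0` each path is constant at `x`. The constant path at `y₀` lifts it, and `triv`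
sends that identity morphism to `1`. -/
theorem LocalTrivialization.smoothTransportNear_zero (L : LocalTrivialization hπ tra) {m : ℕ}
    {U : Set (EuclideanSpace ℝ (Fin m))} (hU : IsOpen U) {x z : M}
    (c : EuclideanSpace ℝ (Fin m) → SmoothPath n x z) {y₀ : Y} (h₀ : π y₀ = x)
    {u₀ : EuclideanSpace ℝ (Fin m)} (hu₀ : u₀ ∈ U) : L.SmoothTransportNear U c h₀ u₀ 0 := by
  refine ⟨U, fun _ => y₀, fun _ => 1, hU, hu₀, subset_rfl, contMDiffOn_const, contMDiffOn_const,
    fun u _ => ⟨h₀.trans (c u).apply_zero.symm, ?_⟩⟩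
  rw [L.map_comp_frame (SmoothPath.const d y₀) _ h₀]
  · exact congrArg (fun g : G => (L.frame y₀ h₀).hom ≫ leftMulHom k g)
      (L.triv.map_id ⟨y₀⟩)
  · intro t
    simp [SmoothPath.const, SmoothPath.initial, (c u).apply_zero, h₀]

/-- Transport over a piece of a family of paths on which a local section of `π` is available. -/
theorem LocalTrivialization.SmoothTransportNear.step {L : LocalTrivialization hπ tra}
    (hL : L.HasSmoothDescentData) {m : ℕ} {U A : Set (EuclideanSpace ℝ (Fin m))} {x z : M}
    {c : EuclideanSpace ℝ (Fin m) → SmoothPath n x z} (hc : IsSmoothFamily U c) {y₀ : Y}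
    {h₀ : π y₀ = x} {u₀ : EuclideanSpace ℝ (Fin m)} (hA : A ∈ nhds u₀) {V : Set M}
    {σ : M → Y} (hσ : ContMDiffOn (𝓡 n) (𝓡 d) ∞ σ V) (hπσ : ∀ p ∈ V, π (σ p) = p)
    {J : Set ℝ} (hJ : Convex ℝ J) (hJ' : J ⊆ Set.Icc 0 1)
    (hAJ : ∀ u ∈ A, ∀ r ∈ J, (c u).toFun r ∈ V) {s t : ℝ} (hs : s ∈ J) (ht : t ∈ J)
    (H : L.SmoothTransportNear U c h₀ u₀ s) : L.SmoothTransportNear U c h₀ u₀ t := by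
  obtain ⟨W, y, q, hW, hu₀, hWU, hy, hq, hyq⟩ := H
  obtain ⟨htriv, g', hg', hg'L⟩ := hL
  have hst := step_contDiff
  have hr : ∀ r, s + (t - s) * PathTransport.step r ∈ J := fun r => by
    have := hJ hs ht (sub_nonneg.2 (step_le_one r)) (step_nonneg r) (by ring)
    simp only [smul_eq_mul] at this
    convert this using 1
    ring
  -- The lift of the piece from `s` to `t` is its image under `σ`, available only where `c u` stays
  -- in `V` on `J`. Elsewhere a constant path is a default value, since a family assigns a path to
  -- every `u`; smoothness is only ever tested on `W'`.
  have hδ : ∀ u, ∃ (a b : Y) (δ : SmoothPath d a b), u ∈ interior A →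
      a = σ ((c u).toFun s) ∧ b = σ ((c u).toFun t) ∧
        ∀ r, δ.toFun r = σ ((c u).toFun (s + (t - s) * PathTransport.step r)) := by
    intro u
    by_cases hu : u ∈ interior A
    · refine ⟨_, _, ⟨fun r => σ ((c u).toFun (s + (t - s) * PathTransport.step r)), ?_,
        1 / 4, by norm_num, by norm_num, fun r hr => ?_, fun r hr => ?_⟩, fun _ =>
        ⟨rfl, rfl, fun _ => rfl⟩⟩
      · exact hσ.comp_contMDiff ((c u).smooth.comp (ContDiff.contMDiff (by fun_prop)))
          fun r => hAJ u (interior_subset hu) _ (hr r)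
      · simp [step_zero hr]
      · simp [step_one hr]
    · exact ⟨y₀, y₀, SmoothPath.const d y₀, fun h => absurd h hu⟩
  choose a b δ hδ using hδ
  set W' := W ∩ interior A
  have hW' : IsOpen W' := hW.inter isOpen_interior
  have hcV : ∀ u ∈ W', ∀ r ∈ J, (c u).toFun r ∈ V := fun u hu =>
    hAJ u (interior_subset hu.2)
  have hσc : ∀ r ∈ J, ContMDiffOn (𝓡 m) (𝓡 d) ∞ (fun u => σ ((c u).toFun r)) W' := by
    intro r hr
    have e : ContMDiff (𝓡 m) 𝓘(ℝ, EuclideanSpace ℝ (Fin m) × ℝ) ∞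
        (fun u : EuclideanSpace ℝ (Fin m) => (u, r)) := ContDiff.contMDiff (by fun_prop)
    exact hσ.comp (hc.comp e.contMDiffOn fun u hu => ⟨hWU hu.1, hJ' hr⟩)
      fun u hu => hcV u hu r hr
  have ha : ContMDiffOn (𝓡 m) (𝓡 d) ∞ a W' := (hσc s hs).congr fun u hu => (hδ u hu.2).1
  have hb : ContMDiffOn (𝓡 m) (𝓡 d) ∞ b W' := (hσc t ht).congr fun u hu => (hδ u hu.2).2.1
  -- The parameters stay in `J ⊆ [0,1]`, where `c` is jointly smooth, and the values stay in `V`,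
  -- where `σ` is smooth.
  have hfam : IsSmoothFamily W' δ := by
    have e : ContMDiff 𝓘(ℝ, EuclideanSpace ℝ (Fin m) × ℝ) 𝓘(ℝ, EuclideanSpace ℝ (Fin m) × ℝ) ∞
        (fun p : EuclideanSpace ℝ (Fin m) × ℝ => (p.1, s + (t - s) * PathTransport.step p.2)) :=
      ContDiff.contMDiff (by fun_prop)
    refine ContMDiffOn.congr (hσ.comp (hc.comp (e.contMDiffOn (s := W' ×ˢ Set.Icc (0 : ℝ) 1))
      fun p hp => ⟨hWU hp.1.1, hJ' (hr _)⟩) fun p hp => hcV p.1 hp.1 _ (hr _)) fun p hp =>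
      (hδ p.1 hp.1.2).2.2 p.2
  have hπa : ∀ u ∈ W', π (a u) = (c u).toFun s := fun u hu => by
    rw [(hδ u hu.2).1, hπσ _ (hcV u hu s hs)]
  have hπb : ∀ u ∈ W', π (b u) = (c u).toFun t := fun u hu => by
    rw [(hδ u hu.2).2.1, hπσ _ (hcV u hu t ht)]
  -- The earlier stage ended in the frame at `y u`, whereas the new lift starts at `a u`. Both lie
  -- over `c u s`, so the pair is in the fibre product, where `g'` is smooth.
  have hg : ContMDiffOn (𝓡 m) (𝓡 k) ∞ (fun u => g' (y u, a u)) W' :=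
    hg'.comp ((hy.mono Set.inter_subset_left).prodMk ha) fun u hu => by
      obtain ⟨h, -⟩ := hyq u hu.1
      exact h.trans (hπa u hu).symm
  refine ⟨W', b, fun u => (L.triv.map (pathClass (δ u)) : G) * (g' (y u, a u) * q u), hW',
    ⟨hu₀, mem_interior_iff_mem_nhds.2 hA⟩, Set.inter_subset_left.trans hWU, hb,
    (htriv m W' hW' a b δ hfam).mul (hg.mul (hq.mono Set.inter_subset_left)), fun u hu => ?_⟩
  obtain ⟨h, hyq⟩ := hyq u hu.1
  refine ⟨hπb u hu, L.map_comp_frame_initial (c u) (δ u) (fun r => ?_) h₀ h (hπa u hu) (hπb u hu)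
    hyq (L.frame_change hg'L h (hπa u hu)) rfl⟩
  rw [(hδ u hu.2).2.2 r, hπσ _ (hcV u hu _ (hr r))]
  rfl

theorem LocalTrivialization.smoothTransportNear_one [IsManifold (𝓡 n) ∞ M] [IsManifold (𝓡 d) ∞ Y]
    {L : LocalTrivialization hπ tra} (hL : L.HasSmoothDescentData)
    (hsub : Manifold.IsSubmersion (𝓡 d) (𝓡 n) ∞ π) (hsurj : Function.Surjective π) {m : ℕ}
    {U : Set (EuclideanSpace ℝ (Fin m))} (hU : IsOpen U) {x z : M}
    {c : EuclideanSpace ℝ (Fin m) → SmoothPath n x z} (hc : IsSmoothFamily U c) {y₀ : Y}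
    (h₀ : π y₀ = x) {u₀ : EuclideanSpace ℝ (Fin m)} (hu₀ : u₀ ∈ U) :
    L.SmoothTransportNear U c h₀ u₀ 1 := by
  -- The relation "smooth up to `s` implies smooth up to `t`" is transitive, so on the connected
  -- interval it need only hold locally, in both directions.
  have key := (isPreconnected_Icc (a := (0 : ℝ)) (b := 1)).induction₂'
    (fun s t => L.SmoothTransportNear U c h₀ u₀ s → L.SmoothTransportNear U c h₀ u₀ t) ?_
    (fun _ _ _ _ _ _ h h' H => h' (h H)) (Set.left_mem_Icc.2 zero_le_one)
    (Set.right_mem_Icc.2 zero_le_one)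
  · exact key (L.smoothTransportNear_zero hU c h₀ hu₀)
  intro t₀ ht₀
  obtain ⟨y, hy⟩ := hsurj ((c u₀).toFun t₀)
  obtain ⟨V, σ, hV, hyV, hσ, hπσ⟩ := exists_local_section (hsub.isSubmersionAt y)
  -- By joint continuity, one neighbourhood of `u₀` and one interval of times around `t₀` keep the
  -- whole family inside the domain `V` of a single section.
  have hmem := hc.continuousOn (u₀, t₀) ⟨hu₀, ht₀⟩ (hV.mem_nhds (show (c u₀).toFun t₀ ∈ V from hy ▸ hyV))
  rw [nhdsWithin_prod_eq, hU.nhdsWithin_eq hu₀] at hmem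
  obtain ⟨A, hA, B, hB, hAB⟩ := Filter.mem_prod_iff.1 hmem
  obtain ⟨ρ, hρ, hρB⟩ := Metric.mem_nhdsWithin_iff.1 hB
  have hstep : ∀ s ∈ Metric.ball t₀ ρ ∩ Set.Icc 0 1, ∀ t ∈ Metric.ball t₀ ρ ∩ Set.Icc 0 1,
      L.SmoothTransportNear U c h₀ u₀ s → L.SmoothTransportNear U c h₀ u₀ t :=
    fun s hs t ht => .step hL hc hA hσ hπσ ((convex_ball t₀ ρ).inter (convex_Icc 0 1))
      Set.inter_subset_right (fun u hu r hr => hAB (Set.mk_mem_prod hu (hρB hr))) hs ht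
  have h0 : t₀ ∈ Metric.ball t₀ ρ ∩ Set.Icc 0 1 := ⟨Metric.mem_ball_self hρ, ht₀⟩
  filter_upwards [inter_mem_nhdsWithin (Set.Icc 0 1) (Metric.ball_mem_nhds t₀ hρ)] with t ht
  exact ⟨hstep _ h0 _ ht.symm, hstep _ ht.symm _ h0⟩

/-! ### Loops: multiplicativity and comparison with a fixed frame -/

/-- The inner `φ.hom ≫ φ.inv` cancels. No order reversal occurs, since `End` on both sides
multiplies by the same convention and `endEquiv` is multiplicative. -/
theorem loopRestriction_mul (x : M) (φ : tra.obj ⟨x⟩ ≅ (iG k G).obj (SingleObj.star G))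
    (a b : ThinHomotopyGroup n x) :
    loopRestriction tra x φ (a * b) = loopRestriction tra x φ a * loopRestriction tra x φ b := by
  rw [loopRestriction, loopRestriction, loopRestriction, ← map_mul]
  congr 1
  rw [End.mul_def, End.mul_def, tra.map_comp]
  simp

/-- Here `ψ` is a fixed frame at `x`, and `p` moves it to the frame in which the transport is known
to be `q`. Undoing `p` gives the holonomy `p⁻¹ * q` in the frame `ψ`; passing from `ψ` to `φ`
conjugates it by `r`. -/
theorem loopRestriction_eq {x : M} (φ ψ : tra.obj ⟨x⟩ ≅ selfTorsor k G) (γ : ThinHomotopyGroup n x)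
    {p q r : G} (hr : φ.hom = ψ.hom ≫ leftMulHom k r)
    (h : tra.map γ ≫ ψ.hom ≫ leftMulHom k p = ψ.hom ≫ leftMulHom k q) :
    loopRestriction tra x φ γ = r * (p⁻¹ * q) * r⁻¹ := by
  have h1 : tra.map γ ≫ ψ.hom = ψ.hom ≫ leftMulHom k (p⁻¹ * q) := by
    rw [← leftMulHom_comp, ← reassoc_of% h, leftMulHom_comp]
    simp [leftMulHom_one]
  have h2 : φ.inv ≫ tra.map γ ≫ φ.hom = leftMulHom k (r * (p⁻¹ * q) * r⁻¹) := by
    rw [Iso.inv_comp_eq, hr, reassoc_of% h1, Category.assoc, leftMulHom_comp, leftMulHom_comp]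
    simp
  exact (congrArg (endEquiv k G) h2).trans (endEquiv_leftMulHom _)

end Frames

end

end PathTransport

theorem mainTheorem10 (n k : ℕ)
    (M : Type u) [TopologicalSpace M] [ChartedSpace (EuclideanSpace ℝ (Fin n)) M]
    [IsManifold (𝓡 n) ∞ M] [T2Space M] [SecondCountableTopology M]
    (G : Type w) [Group G] [TopologicalSpace G] [ChartedSpace (EuclideanSpace ℝ (Fin k)) G]
    [LieGroup (𝓡 k) ∞ G] [T2Space G] [SecondCountableTopology G]
    (tra : PathTransport.PathGroupoid n M ⥤ PathTransport.GTor k G)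
    (htra : PathTransport.IsTransportFunctor tra) (x : M)
    (φ : tra.obj ⟨x⟩ ≅ (PathTransport.iG k G).obj (SingleObj.star G)) :
    PathTransport.IsHolonomyMap k (PathTransport.loopRestriction tra x φ) := by
  refine ⟨PathTransport.loopRestriction_mul x φ, fun m U hU c hc => ?_⟩
  obtain ⟨d, Y, _, _, _, _, _, π, hπ, hsurj, L, hL⟩ := htra
  obtain ⟨y₀, h₀⟩ := hsurj x
  obtain ⟨-, g', hg', hg'L⟩ := id hL
  -- Any automorphism of the torsor `G` is a left multiplication, so `φ` differs from the frame at
  -- `y₀` by an element `r` independent of `u`.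
  obtain ⟨r, hr⟩ : ∃ r : G, φ.hom = (L.frame y₀ h₀).hom ≫ PathTransport.leftMulHom k r :=
    ⟨PathTransport.endEquiv k G ((L.frame y₀ h₀).inv ≫ φ.hom),
      ((Iso.hom_inv_id_assoc (L.frame y₀ h₀) φ.hom).symm.trans
        (congrArg _ (PathTransport.leftMulHom_endEquiv _).symm))⟩
  refine contMDiffOn_of_locally_contMDiffOn fun u₀ hu₀ => ?_
  obtain ⟨W, y, q, hW, huW, hWU, hy, hq, hyq⟩ :=
    PathTransport.LocalTrivialization.smoothTransportNear_one hL hπ hsurj hU hc h₀ hu₀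
  have hπy : ∀ u ∈ W, π (y u) = x := fun u hu => by
    obtain ⟨h, -⟩ := hyq u hu
    rw [h, (c u).apply_one]
  -- The final lift point `y u` varies with `u` but lies over `x`, because `c u` is a loop; it can
  -- therefore be compared with the constant point `y₀`.
  have hg : ContMDiffOn (𝓡 m) (𝓡 k) ∞ (fun u => g' (y₀, y u)) W :=
    hg'.comp (contMDiffOn_const.prodMk hy) fun u hu => h₀.trans (hπy u hu).symm
  refine ⟨W, hW, huW, ContMDiffOn.congr (contMDiffOn_const.mul ((hg.inv.mul hq).mono
    Set.inter_subset_right) |>.mul contMDiffOn_const) fun u hu =>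
      PathTransport.loopRestriction_eq φ (L.frame y₀ h₀) _ hr ?_⟩
  obtain ⟨h, hyq⟩ := hyq u hu.2
  rw [← L.frame_change hg'L h₀ (hπy u hu.2), L.map_comp_frame_initial_one (c u) _ h, hyq]
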